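/- Let $A\in\mathbb R^{m\times n}$ (with $A^*=A^T$), $b\in\mathbb R^m$, $c\in\mathbb R^n$ and $K=\{x\in\mathbb R^n\mid l\le x\le u\}$, where components of $l$ and $u$ may be $-\infty$ and $+\infty$, respectively. Consider the primal and dual linear programs $$\text{(P)}\ \min\{c^Tx\mid Ax=b,\ x\in K\},\qquad \text{(D)}\ \max\{-\delta_K^*(A^*y-c)+b^Ty\mid y\in\mathbb R^m\},$$ where $\delta_K^*(z)=\sup_{x\in K}\langle x,z\rangle$. Assume that (P) and (D) both have optimal solutions and that $A$ has full row rank. For $\sigma>0$ the augmented Lagrangian of (D) is $$L_\sigma(y;x)=\sup_{s\in K}\Big\{-b^Ty-\langle s,c-A^*y\rangle-\tfrac1{2\sigma}\|s-x\|^2\Big\},$$ and $\Pi_K$ denotes the Euclidean projection onto $K$. Let $0<\sigma_0\le\sigma_1\le\cdots$ (so $\sigma_k\uparrow\sigma_\infty\le\infty$), let $\tau_0\ge\tau_1\ge\cdots$ be positive with $\tau_k\downarrow\tau_\infty>0$, and let $\varepsilon_k\ge 0$ with $\sum_k\varepsilon_k<\infty$. Let $\{(y^k,x^k)\}_{k\ge0}$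 be an infinite sequence generated by the inexact proximal augmented Lagrangian method: $(y^0,x^0)$ is arbitrary and, for all $k\ge0$, with $\psi_k(y)=L_{\sigma_k}(y;x^k)+\frac{\tau_k}{2\sigma_k}\|y-y^k\|^2$, $$\|\nabla\psi_k(y^{k+1})\|\le\frac{\min(\sqrt{\tau_k},1)}{\sigma_k}\,\varepsilon_k,\qquad x^{k+1}=\Pi_K\big(x^k-\sigma_k(c-A^*y^{k+1})\big).$$ Then the following hold. (a) For every $k\ge0$ and every exact minimizer $\bar y^{k+1}$ of $L_{\sigma_k}(\cdot\,;x^k)$ over $\mathbb R^m$, the point $\bar x^{k+1}:=\Pi_K\big(x^k-\sigma_k(c-A^*\bar y^{k+1})\big)$ is the unique solution of $$\min\Big\{c^Tx+\tfrac1{2\sigma_k}\|x-x^k\|^2\ \Big|\ Ax=b,\ x\in K\Big\}.$$ (b) There is $\bar\sigma>0$, independent of $k$, such that for every $k\ge0$ and every penalty value $\sigma\ge\bar\sigma$ (in particular for $\sigma=\sigma_k$ whenever $\sigma_k\ge\bar\sigma$), if $\bar y$ is an exact minimizer of $L_{\sigma}(\cdot\,;x^k)$ over $\mathbb R^m$,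 then $\Pi_K\big(x^k-\sigma(c-A^*\bar y)\big)$ solves (P). (c) For every $k\ge0$, if $x^k$ solves (P) and $\bar y^{k+1}$ is an exact minimizer of $L_{\sigma_k}(\cdot\,;x^k)$ over $\mathbb R^m$, then $\bar y^{k+1}$ solves (D). -/

import Mathlib

open Filter Topology
open scoped InnerProductSpace

noncomputable section

namespace Snipal

/-- The data `A, b, c, l, u` of the linear program
`min {cᵀx | A x = b, l ≤ x ≤ u}`.  Components of `l` and `u` may be `-∞` and `+∞`. -/
structure LPData (m n : ℕ) where
  A : Matrix (Fin m) (Fin n) ℝ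
  b : EuclideanSpace ℝ (Fin m)
  c : EuclideanSpace ℝ (Fin n)
  l : Fin n → EReal
  u : Fin n → EReal

/-- The Euclidean projector onto `D`: a point of `D` at minimal distance to `x`
(it exists and is unique when `D` is nonempty, closed and convex). -/
def proj {E : Type*} [NormedAddCommGroup E] (D : Set E) (x : E) : E :=
  Classical.epsilon fun p => p ∈ D ∧ ∀ d ∈ D, ‖x - p‖ ≤ ‖x - d‖

/-- The Fenchel conjugate `δ_D^*(z) = sup_{x ∈ D} ⟨x, z⟩` of the indicator function of `D`. -/
def indicatorConj {E : Type*} [NormedAddCommGroup E] [InnerProductSpace ℝ E]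
    (D : Set E) (z : E) : EReal :=
  ⨆ x ∈ D, ((⟪x, z⟫_ℝ : ℝ) : EReal)

namespace LPData

variable {m n : ℕ} (P : LPData m n)

/-- The linear map `x ↦ A x`. -/
def map (x : EuclideanSpace ℝ (Fin n)) : EuclideanSpace ℝ (Fin m) :=
  Matrix.toEuclideanLin P.A x

/-- The adjoint map `y ↦ A^* y`. -/
def adj (y : EuclideanSpace ℝ (Fin m)) : EuclideanSpace ℝ (Fin n) :=
  Matrix.toEuclideanLin P.A.transpose y

/-- The box `K = {x | l ≤ x ≤ u}`. -/
def K : Set (EuclideanSpace ℝ (Fin n)) :=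
  {x | ∀ i, P.l i ≤ ((x i : ℝ) : EReal) ∧ ((x i : ℝ) : EReal) ≤ P.u i}

/-- The feasible set `{x ∈ K | A x = b}` of (P). -/
def feasible : Set (EuclideanSpace ℝ (Fin n)) :=
  {x | x ∈ P.K ∧ P.map x = P.b}

/-- `x` is an optimal solution of (P): `min {cᵀx + δ_K(x) | A x = b}`. -/
def IsPrimalSolution (x : EuclideanSpace ℝ (Fin n)) : Prop :=
  x ∈ P.feasible ∧ IsMinOn (fun x' => ⟪P.c, x'⟫_ℝ) P.feasible x

/-- The objective `-δ_K^*(A^* y - c) + bᵀy` of (D). -/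
def dualObj (y : EuclideanSpace ℝ (Fin m)) : EReal :=
  -indicatorConj P.K (P.adj y - P.c) + ((⟪P.b, y⟫_ℝ : ℝ) : EReal)

/-- `y` is an optimal solution of (D): it is feasible (its objective value is not `-∞`) and
maximizes the dual objective. -/
def IsDualSolution (y : EuclideanSpace ℝ (Fin m)) : Prop :=
  P.dualObj y ≠ ⊥ ∧ IsMaxOn P.dualObj Set.univ y

/-- (P) and (D) both have solutions, and `A` has full row rank. -/
def SolvableFullRank : Prop :=
  (∃ x, P.IsPrimalSolution x) ∧ (∃ y, P.IsDualSolution y) ∧ P.A.rank = m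

/-- The finite part `-bᵀy - ⟨x, c - A^* y⟩` of the Lagrangian
`l(y; x) = -bᵀy - ⟨x, c - A^* y⟩ - δ_K(x)` of (D). -/
def lagrangian (y : EuclideanSpace ℝ (Fin m)) (x : EuclideanSpace ℝ (Fin n)) : ℝ :=
  -⟪P.b, y⟫_ℝ - ⟪x, P.c - P.adj y⟫_ℝ

/-- The augmented Lagrangian `L_σ(y; x) = sup_s {l(y; s) - ‖s - x‖² / (2σ)}` of (D).
As `l(y; s) = -∞` off `K`, the supremum runs over `s ∈ K`; it is finite when `σ > 0` and
`K` is nonempty (see `bddAbove_augLagrangian`). -/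
def augLagrangian (σ : ℝ) (y : EuclideanSpace ℝ (Fin m)) (x : EuclideanSpace ℝ (Fin n)) : ℝ :=
  ⨆ s : P.K, (P.lagrangian y s - 1 / (2 * σ) * ‖(s : EuclideanSpace ℝ (Fin n)) - x‖ ^ 2)

theorem bddAbove_augLagrangian {σ : ℝ} (hσ : 0 < σ) (y : EuclideanSpace ℝ (Fin m))
    (x : EuclideanSpace ℝ (Fin n)) :
    BddAbove (Set.range fun s : P.K =>
      P.lagrangian y s - 1 / (2 * σ) * ‖(s : EuclideanSpace ℝ (Fin n)) - x‖ ^ 2) := by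
  refine ⟨-⟪P.b, y⟫_ℝ - ⟪x, P.c - P.adj y⟫_ℝ + σ / 2 * ‖P.c - P.adj y‖ ^ 2, ?_⟩
  rintro _ ⟨s, rfl⟩
  simp only [lagrangian]
  set v := P.c - P.adj y
  set r := (s : EuclideanSpace ℝ (Fin n)) - x with hr
  have h1 : ⟪(s : EuclideanSpace ℝ (Fin n)), v⟫_ℝ = ⟪x, v⟫_ℝ + ⟪r, v⟫_ℝ := by
    rw [hr, inner_sub_left]; ring
  have h2 : |⟪r, v⟫_ℝ| ≤ ‖r‖ * ‖v‖ := abs_real_inner_le_norm r v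
  have h3 : -(‖r‖ * ‖v‖) ≤ ⟪r, v⟫_ℝ := (abs_le.mp h2).1
  have h4 : 1 / (2 * σ) * ‖r‖ ^ 2 + σ / 2 * ‖v‖ ^ 2 - ‖r‖ * ‖v‖
      = 1 / (2 * σ) * (‖r‖ - σ * ‖v‖) ^ 2 := by
    field_simp
    ring
  have h5 : 0 ≤ 1 / (2 * σ) * (‖r‖ - σ * ‖v‖) ^ 2 := by positivity
  linarith

/-- The multiplier update `Π_K(x - σ (c - A^* y))`. -/
def primalUpdate (σ : ℝ) (y : EuclideanSpace ℝ (Fin m)) (x : EuclideanSpace ℝ (Fin n)) :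
    EuclideanSpace ℝ (Fin n) :=
  proj P.K (x - σ • (P.c - P.adj y))

/-- `y` is an exact minimizer of `L_σ(·; x)` over `ℝᵐ`. -/
def IsExactMinimizer (σ : ℝ) (x : EuclideanSpace ℝ (Fin n)) (y : EuclideanSpace ℝ (Fin m)) :
    Prop :=
  IsMinOn (fun y' => P.augLagrangian σ y' x) Set.univ y

/-- `x` solves the proximal problem `min {cᵀx + ‖x - x₀‖² / (2σ) | A x = b, x ∈ K}`. -/
def IsProxSolution (σ : ℝ) (x₀ x : EuclideanSpace ℝ (Fin n)) : Prop :=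
  x ∈ P.feasible ∧
    IsMinOn (fun x' => ⟪P.c, x'⟫_ℝ + 1 / (2 * σ) * ‖x' - x₀‖ ^ 2) P.feasible x

/-- The inner objective `ψ(y) = L_σ(y; x₀) + τ / (2σ) ‖y - y₀‖²`. -/
def innerObj (σ τ : ℝ) (x₀ : EuclideanSpace ℝ (Fin n)) (y₀ y : EuclideanSpace ℝ (Fin m)) : ℝ :=
  P.augLagrangian σ y x₀ + τ / (2 * σ) * ‖y - y₀‖ ^ 2

/-- `(y^k, x^k)` is an infinite sequence generated by the inexact proximal augmented Lagrangian
method from the start `(y^0, x^0)` with parameters `σ_k > 0` nondecreasing (so that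
`σ_k ↑ σ_∞` for some `σ_∞ ∈ (0, ∞]`) and `τ_k`, where `y^{k+1}` approximately minimizes the inner
objective `ψ_k` in the sense that
`‖∇ψ_k(y^{k+1})‖ ≤ min(√τ_k, 1) / σ_k * ε_k` with `ε_k ≥ 0` summable, and
`x^{k+1} = Π_K(x^k - σ_k (c - A^* y^{k+1}))`. -/
structure IsSnipalSequence (σ τ ε : ℕ → ℝ) (y : ℕ → EuclideanSpace ℝ (Fin m))
    (x : ℕ → EuclideanSpace ℝ (Fin n)) : Prop where
  sigma_pos : ∀ k, 0 < σ k
  sigma_mono : Monotone σ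
  eps_nonneg : ∀ k, 0 ≤ ε k
  eps_summable : Summable ε
  stopping : ∀ k, ‖gradient (P.innerObj (σ k) (τ k) (x k) (y k)) (y (k + 1))‖
    ≤ min (Real.sqrt (τ k)) 1 / σ k * ε k
  update : ∀ k, x (k + 1) = P.primalUpdate (σ k) (y (k + 1)) (x k)

end LPData

/-- `τ_k ↓ τ_∞` for some `τ_∞ > 0`. -/
def DecreasesToPos (τ : ℕ → ℝ) : Prop :=
  (∀ k, 0 < τ k) ∧ Antitone τ ∧ ∃ τ' : ℝ, 0 < τ' ∧ Tendsto τ atTop (𝓝 τ')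

end Snipal

end

/-! Write `p` for the multiplier update from the prox center `x` at an exact minimizer `ȳ`. The
augmented Lagrangian is a supremum of strongly concave functions of `s`, attained at the update, so
its gradient in `y` is `A p - b`. At `ȳ` this vanishes, hence `p` is feasible; on `A s = b` the
Lagrangian is `-cᵀs`, and strong concavity makes `p` the unique prox point, which is (a)
(`IsExactMinimizer.add_le`). If `x` is already optimal, then `p = x`, and the projection inequality
at `p` becomes the optimality condition for `ȳ`, which is (c).

For (b), `p` minimizes the perturbed cost `c + (p - x)/σ` over the feasible set. A polyhedron has
finitely many cones of feasible directions, so a small enough perturbation yields only solutions of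
(P) (`exists_pos_isPrimalSolution_of_perturbation`). Since `‖p - x‖ ≤ ‖x - z‖` for any solution `z`,
a threshold uniform in `k` needs only that `x^k` be bounded. That follows from Fejér monotonicity,
up to the summable errors `ε_k`, towards a pair `(z, w)` with `w` a multiplier obtained from Farkas'
lemma (`inexact_step_le`). -/

/-- **Farkas' lemma** for finitely many linear functionals. -/
theorem exists_nonneg_sum_smul_eq_of_forall_nonneg {ι V : Type*} [AddCommGroup V] [Module ℝ V]
    (s : Finset ι) (f : ι → V →ₗ[ℝ] ℝ) (g : V →ₗ[ℝ] ℝ)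
    (h : ∀ x, (∀ i ∈ s, 0 ≤ f i x) → 0 ≤ g x) :
    ∃ w : ι → ℝ, (∀ i, 0 ≤ w i) ∧ ∀ x, g x = ∑ i ∈ s, w i * f i x := by
  classical
  induction s using Finset.induction_on generalizing f g with
  | empty =>
    refine ⟨fun _ => 0, fun _ => le_rfl, fun x => ?_⟩
    have h1 := h x (by simp)
    have h2 := h (-x) (by simp)
    rw [map_neg] at h2
    simp only [Finset.sum_empty]
    linarith
  | insert a s ha ih =>
    by_cases hs : ∀ x, (∀ i ∈ s, 0 ≤ f i x) → 0 ≤ g x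
    · obtain ⟨w, hw, hg⟩ := ih f g hs
      refine ⟨Function.update w a 0, fun i => ?_, fun x => ?_⟩
      · by_cases hi : i = a
        · simp [hi]
        · simpa [hi] using hw i
      · rw [Finset.sum_insert ha, hg x]
        simp only [Function.update_self, zero_mul, zero_add]
        refine Finset.sum_congr rfl fun i hi => ?_
        rw [Function.update_of_ne (ne_of_mem_of_not_mem hi ha)]
    · push Not at hs
      obtain ⟨z, hz, hgz⟩ := hs
      have hfz : f a z < 0 := by
        by_contra hneg
        refine absurd (h z fun i hi => ?_) (not_le.mpr hgz)
        rcases Finset.mem_insert.mp hi with rfl | hi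
        · exact not_lt.mp hneg
        · exact hz i hi
      -- With `r * f a z = -1`, the map `x ↦ x + (r * f a x) • z` projects onto `ker (f a)` along
      -- `z`. The induction hypothesis is applied to the functionals composed with it.
      set r : ℝ := (-(f a z))⁻¹ with hr
      have hrpos : 0 < r := inv_pos.mpr (by linarith)
      have hrz : r * f a z = -1 := by
        rw [hr, inv_neg, neg_mul, inv_mul_cancel₀ hfz.ne]
      obtain ⟨w, hw, hg⟩ := ih (fun i => f i + (r * f i z) • f a) (g + (r * g z) • f a) (by
        intro x hx
        have := h (x + (r * f a x) • z) (by
          intro i hi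
          rcases Finset.mem_insert.mp hi with rfl | hi
          · simp only [map_add, map_smul, smul_eq_mul]
            have : f i x + r * f i x * f i z = f i x * (1 + r * f i z) := by ring
            rw [this, hrz]; simp
          · have := hx i hi
            simp only [LinearMap.add_apply, LinearMap.smul_apply, smul_eq_mul] at this
            simp only [map_add, map_smul, smul_eq_mul]
            linarith)
        simp only [map_add, map_smul, smul_eq_mul] at this
        simp only [LinearMap.add_apply, LinearMap.smul_apply, smul_eq_mul]
        linarith)
      -- The weight of `a` collects the `f a x` terms of the composed identity; it is nonnegative
      -- because `f i z ≥ 0` on `s` and `g z < 0`.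
      refine ⟨Function.update w a (∑ i ∈ s, w i * (r * f i z) - r * g z), fun i => ?_,
        fun x => ?_⟩
      · by_cases hi : i = a
        · subst hi
          rw [Function.update_self]
          have h1 : 0 ≤ ∑ j ∈ s, w j * (r * f j z) :=
            Finset.sum_nonneg fun j hj => mul_nonneg (hw j) (mul_nonneg hrpos.le (hz j hj))
          nlinarith
        · simpa [hi] using hw i
      · have h1 := hg x
        simp only [LinearMap.add_apply, LinearMap.smul_apply, smul_eq_mul] at h1
        have h2 : ∑ i ∈ s, Function.update w a (∑ i ∈ s, w i * (r * f i z) - r * g z) i * f i x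
            = ∑ i ∈ s, w i * f i x := Finset.sum_congr rfl fun i hi => by
          rw [Function.update_of_ne (ne_of_mem_of_not_mem hi ha)]
        rw [Finset.sum_insert ha, h2, Function.update_self, sub_mul, Finset.sum_mul]
        have h3 : ∑ i ∈ s, w i * (f i x + r * f i z * f a x)
            = ∑ i ∈ s, w i * f i x + ∑ i ∈ s, w i * (r * f i z) * f a x := by
          rw [← Finset.sum_add_distrib]
          exact Finset.sum_congr rfl fun i _ => by ring
        linarith

/-- A function with a quadratic bound on its first-order remainder has a gradient. -/
theorem HasGradientAt.of_abs_sub_le {F : Type*} [NormedAddCommGroup F] [InnerProductSpace ℝ F]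
    [CompleteSpace F] {f : F → ℝ} {g y : F} {C : ℝ}
    (h : ∀ z, |f z - f y - ⟪g, z - y⟫_ℝ| ≤ C * ‖z - y‖ ^ 2) : HasGradientAt f g y := by
  rw [hasGradientAt_iff_isLittleO]
  have h1 : (fun z => f z - f y - ⟪g, z - y⟫_ℝ) =O[𝓝 y] fun z => ‖z - y‖ ^ 2 :=
    Asymptotics.IsBigO.of_bound C (Eventually.of_forall fun z => by simpa using h z)
  refine h1.trans_isLittleO ?_
  have h2 : (fun z : F => ‖z - y‖) =o[𝓝 y] fun _ => (1 : ℝ) := by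
    rw [Asymptotics.isLittleO_one_iff]
    have : Continuous fun z : F => ‖z - y‖ := by fun_prop
    simpa using this.tendsto y
  have h3 := h2.mul_isBigO (Asymptotics.isBigO_refl (fun z : F => ‖z - y‖) (𝓝 y))
  simp only [one_mul, ← pow_two] at h3
  exact h3.of_norm_right

namespace Snipal

/-! ### Euclidean projection onto a closed convex set -/

section Projection

variable {E : Type*} [NormedAddCommGroup E] [InnerProductSpace ℝ E] [CompleteSpace E]
  {D : Set E}

theorem proj_spec (hne : D.Nonempty) (hcl : IsClosed D) (hconv : Convex ℝ D) (x : E) :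
    proj D x ∈ D ∧ ∀ d ∈ D, ⟪x - proj D x, d - proj D x⟫_ℝ ≤ 0 := by
  have hbdd : BddBelow (Set.range fun w : D => ‖x - w‖) :=
    ⟨0, by rintro _ ⟨w, rfl⟩; exact norm_nonneg _⟩
  obtain ⟨p, hp, hpe⟩ := exists_norm_eq_iInf_of_complete_convex hne hcl.isComplete hconv x
  have hex : ∃ p, p ∈ D ∧ ∀ d ∈ D, ‖x - p‖ ≤ ‖x - d‖ :=
    ⟨p, hp, fun d hd => hpe.le.trans (ciInf_le hbdd ⟨d, hd⟩)⟩
  obtain ⟨h1, h2⟩ := Classical.epsilon_spec hex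
  refine ⟨h1, (norm_eq_iInf_iff_real_inner_le_zero hconv h1).mp (le_antisymm ?_ ?_)⟩
  · have := hne.to_subtype
    exact le_ciInf fun w => h2 w w.2
  · exact ciInf_le hbdd (⟨_, h1⟩ : D)

/-- Adding the variational inequalities at both projections gives `‖p - q‖² ≤ ⟪x - y, p - q⟫`;
Cauchy–Schwarz finishes. -/
theorem norm_proj_sub_proj_le (hne : D.Nonempty) (hcl : IsClosed D) (hconv : Convex ℝ D)
    (x y : E) : ‖proj D x - proj D y‖ ≤ ‖x - y‖ := by
  obtain ⟨hx, hx'⟩ := proj_spec hne hcl hconv x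
  obtain ⟨hy, hy'⟩ := proj_spec hne hcl hconv y
  set p := proj D x
  set q := proj D y
  have h1 := hx' q hy
  have h2 := hy' p hx
  have h3 : ⟪x - y, p - q⟫_ℝ = ‖p - q‖ ^ 2 - ⟪x - p, q - p⟫_ℝ - ⟪y - q, p - q⟫_ℝ := by
    rw [← real_inner_self_eq_norm_sq, show q - p = -(p - q) by abel, inner_neg_right,
      show x - y = (p - q) + (x - p) - (y - q) by abel, inner_sub_left, inner_add_left]
    ring
  have h4 := real_inner_le_norm (x - y) (p - q)
  have h5 : ‖p - q‖ * ‖p - q‖ ≤ ‖x - y‖ * ‖p - q‖ := by nlinarith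
  by_cases h0 : ‖p - q‖ = 0
  · rw [h0]; exact norm_nonneg _
  · exact le_of_mul_le_mul_right h5 (lt_of_le_of_ne (norm_nonneg _) (Ne.symm h0))

end Projection

namespace LPData

variable {m n : ℕ} (P : LPData m n)

/-! ### The adjoint map and the box -/

theorem inner_adj (y : EuclideanSpace ℝ (Fin m)) (x : EuclideanSpace ℝ (Fin n)) :
    ⟪P.adj y, x⟫_ℝ = ⟪y, P.map x⟫_ℝ := by
  have h : P.adj y = (Matrix.toEuclideanLin P.A).adjoint y := by
    rw [← Matrix.toEuclideanLin_conjTranspose_eq_adjoint, Matrix.conjTranspose_eq_transpose_of_trivial]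
    rfl
  rw [h, LinearMap.adjoint_inner_left]
  rfl

theorem map_sub (x x' : EuclideanSpace ℝ (Fin n)) : P.map (x - x') = P.map x - P.map x' :=
  _root_.map_sub _ _ _

theorem adj_sub (y y' : EuclideanSpace ℝ (Fin m)) : P.adj (y - y') = P.adj y - P.adj y' :=
  _root_.map_sub _ _ _

theorem map_add_smul (x d : EuclideanSpace ℝ (Fin n)) (t : ℝ) :
    P.map (x + t • d) = P.map x + t • P.map d := by
  simp [map]

theorem exists_norm_adj_le :
    ∃ C : ℝ, 0 ≤ C ∧ ∀ y, ‖P.adj y‖ ≤ C * ‖y‖ :=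
  ⟨‖(Matrix.toEuclideanLin P.A.transpose).toContinuousLinearMap‖, norm_nonneg _, fun y =>
    (Matrix.toEuclideanLin P.A.transpose).toContinuousLinearMap.le_opNorm y⟩

theorem isClosed_K : IsClosed P.K := by
  have hc : ∀ i, Continuous fun x : EuclideanSpace ℝ (Fin n) => ((x i : ℝ) : EReal) := fun i =>
    continuous_coe_real_ereal.comp (by fun_prop)
  have : P.K = ⋂ i, ({x | P.l i ≤ ((x i : ℝ) : EReal)} ∩ {x | ((x i : ℝ) : EReal) ≤ P.u i}) := by
    ext x; simp [K]
  rw [this]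
  exact isClosed_iInter fun i => (isClosed_le continuous_const (hc i)).inter
    (isClosed_le (hc i) continuous_const)

theorem convex_K : Convex ℝ P.K := by
  intro x hx z hz a b ha hb hab i
  have hx := hx i
  have hz := hz i
  have h1 : min (x i) (z i) ≤ (a • x + b • z) i :=
    Convex.min_le_combo (x i) (z i) ha hb hab
  have h2 : (a • x + b • z) i ≤ max (x i) (z i) :=
    Convex.combo_le_max (x i) (z i) ha hb hab
  constructor
  · refine le_trans ?_ (EReal.coe_le_coe_iff.mpr h1)
    rcases min_choice (x i) (z i) with h | h <;> rw [h]
    exacts [hx.1, hz.1]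
  · refine le_trans (EReal.coe_le_coe_iff.mpr h2) ?_
    rcases max_choice (x i) (z i) with h | h <;> rw [h]
    exacts [hx.2, hz.2]

/-! ### The augmented Lagrangian and its gradient -/

variable {P}

theorem primalUpdate_spec (hK : P.K.Nonempty) (σ : ℝ) (y : EuclideanSpace ℝ (Fin m))
    (x : EuclideanSpace ℝ (Fin n)) :
    P.primalUpdate σ y x ∈ P.K ∧ ∀ d ∈ P.K,
      ⟪x - σ • (P.c - P.adj y) - P.primalUpdate σ y x, d - P.primalUpdate σ y x⟫_ℝ ≤ 0 :=
  proj_spec hK P.isClosed_K P.convex_K _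

theorem norm_primalUpdate_sub_le (hK : P.K.Nonempty) {σ : ℝ} (hσ : 0 < σ)
    (y y' : EuclideanSpace ℝ (Fin m)) (x : EuclideanSpace ℝ (Fin n)) :
    ‖P.primalUpdate σ y' x - P.primalUpdate σ y x‖ ≤ σ * ‖P.adj (y' - y)‖ := by
  refine (norm_proj_sub_proj_le hK P.isClosed_K P.convex_K _ _).trans_eq ?_
  rw [show x - σ • (P.c - P.adj y') - (x - σ • (P.c - P.adj y)) = σ • P.adj (y' - y) by
    rw [adj_sub]; module, norm_smul, Real.norm_of_nonneg hσ.le]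

/-- The function maximized in the augmented Lagrangian is strongly concave, with maximizer the
multiplier update. -/
theorem lagrangian_sub_add_le (hK : P.K.Nonempty) {σ : ℝ} (hσ : 0 < σ)
    (y : EuclideanSpace ℝ (Fin m)) (x : EuclideanSpace ℝ (Fin n))
    {s : EuclideanSpace ℝ (Fin n)} (hs : s ∈ P.K) :
    P.lagrangian y s - 1 / (2 * σ) * ‖s - x‖ ^ 2
        + 1 / (2 * σ) * ‖s - P.primalUpdate σ y x‖ ^ 2
      ≤ P.lagrangian y (P.primalUpdate σ y x)
        - 1 / (2 * σ) * ‖P.primalUpdate σ y x - x‖ ^ 2 := by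
  have h := (primalUpdate_spec hK σ y x).2 s hs
  set p := P.primalUpdate σ y x
  simp only [lagrangian]
  set v := P.c - P.adj y
  have h1 : ‖s - x‖ ^ 2 = ‖s - p‖ ^ 2 + 2 * ⟪s - p, p - x⟫_ℝ + ‖p - x‖ ^ 2 := by
    rw [← norm_add_sq_real]; congr 2; abel
  have h2 : ⟪x - σ • v - p, s - p⟫_ℝ = -⟪s - p, p - x⟫_ℝ - σ * (⟪s, v⟫_ℝ - ⟪p, v⟫_ℝ) := by
    rw [show x - σ • v - p = -(p - x) - σ • v by abel, inner_sub_left, inner_neg_left,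
      real_inner_smul_left, real_inner_comm, real_inner_comm (s - p) v, inner_sub_left s p v]
  rw [h2] at h
  have h3 : -⟪s, v⟫_ℝ + ⟪p, v⟫_ℝ - 1 / σ * ⟪s - p, p - x⟫_ℝ ≤ 0 := by
    have : -⟪s, v⟫_ℝ + ⟪p, v⟫_ℝ - 1 / σ * ⟪s - p, p - x⟫_ℝ
        = 1 / σ * (-⟪s - p, p - x⟫_ℝ - σ * (⟪s, v⟫_ℝ - ⟪p, v⟫_ℝ)) := by
      field_simp; ring
    rw [this]
    exact mul_nonpos_of_nonneg_of_nonpos (by positivity) h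
  have h4 : 1 / (2 * σ) * ‖s - x‖ ^ 2 = 1 / (2 * σ) * ‖s - p‖ ^ 2
      + 1 / σ * ⟪s - p, p - x⟫_ℝ + 1 / (2 * σ) * ‖p - x‖ ^ 2 := by
    rw [h1]; field_simp
  linarith

theorem augLagrangian_eq (hK : P.K.Nonempty) {σ : ℝ} (hσ : 0 < σ)
    (y : EuclideanSpace ℝ (Fin m)) (x : EuclideanSpace ℝ (Fin n)) :
    P.augLagrangian σ y x = P.lagrangian y (P.primalUpdate σ y x)
        - 1 / (2 * σ) * ‖P.primalUpdate σ y x - x‖ ^ 2 := by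
  have := hK.to_subtype
  refine le_antisymm (ciSup_le fun s => ?_) ?_
  · have := lagrangian_sub_add_le hK hσ y x s.2
    have h2 : 0 ≤ 1 / (2 * σ) * ‖(s : EuclideanSpace ℝ (Fin n)) - P.primalUpdate σ y x‖ ^ 2 := by
      positivity
    linarith
  · exact le_ciSup (P.bddAbove_augLagrangian hσ y x) ⟨_, (primalUpdate_spec hK σ y x).1⟩

theorem lagrangian_sub_lagrangian (y y' : EuclideanSpace ℝ (Fin m))
    (s : EuclideanSpace ℝ (Fin n)) :
    P.lagrangian y' s - P.lagrangian y s = ⟪P.map s - P.b, y' - y⟫_ℝ := by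
  simp only [lagrangian, inner_sub_right, inner_sub_left]
  rw [real_inner_comm (P.adj y), real_inner_comm (P.adj y'), inner_adj, inner_adj,
    real_inner_comm y, real_inner_comm y', real_inner_comm y (P.map s),
    real_inner_comm y' (P.map s)]
  ring

/-- Each update is a competitor in the other's supremum, so the increment lies between `⟪A p - b, y'
- y⟫` and `⟪A p' - b, y' - y⟫`. These differ by at most `σ C² ‖y' - y‖²`, as the update is Lipschitz
in `A^* y` with constant `σ`. -/
theorem augLagrangian_remainder (hK : P.K.Nonempty) {σ : ℝ} (hσ : 0 < σ)
    (x : EuclideanSpace ℝ (Fin n)) :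
    ∃ C : ℝ, ∀ y y',
      |P.augLagrangian σ y' x - P.augLagrangian σ y x
        - ⟪P.map (P.primalUpdate σ y x) - P.b, y' - y⟫_ℝ| ≤ C * ‖y' - y‖ ^ 2 := by
  obtain ⟨C, hC, hA⟩ := P.exists_norm_adj_le
  refine ⟨σ * C * C, fun y y' => ?_⟩
  have e := augLagrangian_eq hK hσ y x
  have e' := augLagrangian_eq hK hσ y' x
  have h1 := lagrangian_sub_add_le hK hσ y x (primalUpdate_spec hK σ y' x).1
  have h2 := lagrangian_sub_add_le hK hσ y' x (primalUpdate_spec hK σ y x).1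
  have h3 := norm_primalUpdate_sub_le hK hσ y y' x
  set p := P.primalUpdate σ y x
  set p' := P.primalUpdate σ y' x
  have h4 : 0 ≤ 1 / (2 * σ) * ‖p' - p‖ ^ 2 := by positivity
  have h4' : 0 ≤ 1 / (2 * σ) * ‖p - p'‖ ^ 2 := by positivity
  have h5 := P.lagrangian_sub_lagrangian y y' p
  have h6 := P.lagrangian_sub_lagrangian y y' p'
  have h7 : ⟪P.map p' - P.b, y' - y⟫_ℝ - ⟪P.map p - P.b, y' - y⟫_ℝ ≤ σ * C * C * ‖y' - y‖ ^ 2 := by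
    rw [← inner_sub_left, show P.map p' - P.b - (P.map p - P.b) = P.map (p' - p) by
      rw [map_sub]; abel, real_inner_comm, ← inner_adj]
    have h8 := hA (y' - y)
    have h9 := real_inner_le_norm (P.adj (y' - y)) (p' - p)
    have h10 : ‖P.adj (y' - y)‖ * ‖p' - p‖ ≤ (C * ‖y' - y‖) * (σ * (C * ‖y' - y‖)) :=
      mul_le_mul h8 (h3.trans (mul_le_mul_of_nonneg_left h8 hσ.le)) (norm_nonneg _)
        (by positivity)
    nlinarith
  rw [abs_le]
  constructor <;> linarith

theorem hasGradientAt_augLagrangian (hK : P.K.Nonempty) {σ : ℝ} (hσ : 0 < σ)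
    (x : EuclideanSpace ℝ (Fin n)) (y : EuclideanSpace ℝ (Fin m)) :
    HasGradientAt (fun y => P.augLagrangian σ y x) (P.map (P.primalUpdate σ y x) - P.b) y := by
  obtain ⟨C, hC⟩ := augLagrangian_remainder hK hσ x
  exact .of_abs_sub_le (hC y)

theorem hasGradientAt_innerObj (hK : P.K.Nonempty) {σ : ℝ} (hσ : 0 < σ) (τ : ℝ)
    (x : EuclideanSpace ℝ (Fin n)) (y₀ y : EuclideanSpace ℝ (Fin m)) :
    HasGradientAt (P.innerObj σ τ x y₀)
      (P.map (P.primalUpdate σ y x) - P.b + (τ / σ) • (y - y₀)) y := by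
  obtain ⟨C, hC⟩ := augLagrangian_remainder hK hσ x
  refine .of_abs_sub_le (C := C + |τ / (2 * σ)|) fun z => ?_
  have h1 : ‖z - y₀‖ ^ 2 = ‖z - y‖ ^ 2 + 2 * ⟪y - y₀, z - y⟫_ℝ + ‖y - y₀‖ ^ 2 := by
    rw [real_inner_comm, ← norm_add_sq_real]; congr 2; abel
  have h2 : P.innerObj σ τ x y₀ z - P.innerObj σ τ x y₀ y
        - ⟪P.map (P.primalUpdate σ y x) - P.b + (τ / σ) • (y - y₀), z - y⟫_ℝ
      = (P.augLagrangian σ z x - P.augLagrangian σ y x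
        - ⟪P.map (P.primalUpdate σ y x) - P.b, z - y⟫_ℝ) + τ / (2 * σ) * ‖z - y‖ ^ 2 := by
    simp only [innerObj]
    rw [inner_add_left, real_inner_smul_left, h1]
    field_simp
    ring
  rw [h2]
  refine (abs_add_le _ _).trans ?_
  rw [add_mul, abs_mul, abs_of_nonneg (sq_nonneg ‖z - y‖)]
  exact add_le_add (hC y z) le_rfl

/-! ### Exact minimizers and the proximal problem -/

theorem IsExactMinimizer.map_primalUpdate (hK : P.K.Nonempty) {σ : ℝ} (hσ : 0 < σ)
    {x : EuclideanSpace ℝ (Fin n)} {y : EuclideanSpace ℝ (Fin m)}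
    (h : P.IsExactMinimizer σ x y) : P.map (P.primalUpdate σ y x) = P.b := by
  have h1 := (hasGradientAt_augLagrangian hK hσ x y).hasFDerivAt
  have h2 := (h.isLocalMin univ_mem).hasFDerivAt_eq_zero h1
  rw [LinearIsometryEquiv.map_eq_zero_iff, sub_eq_zero] at h2
  exact h2

theorem IsExactMinimizer.mem_feasible (hK : P.K.Nonempty) {σ : ℝ} (hσ : 0 < σ)
    {x : EuclideanSpace ℝ (Fin n)} {y : EuclideanSpace ℝ (Fin m)}
    (h : P.IsExactMinimizer σ x y) : P.primalUpdate σ y x ∈ P.feasible :=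
  ⟨(primalUpdate_spec hK σ y x).1, h.map_primalUpdate hK hσ⟩

theorem lagrangian_of_map_eq {s : EuclideanSpace ℝ (Fin n)} (hs : P.map s = P.b)
    (y : EuclideanSpace ℝ (Fin m)) : P.lagrangian y s = -⟪P.c, s⟫_ℝ := by
  simp only [lagrangian, inner_sub_right]
  rw [real_inner_comm (P.adj y), inner_adj, hs, real_inner_comm P.b, real_inner_comm s]
  ring

/-- On feasible points the dual variable drops out of the Lagrangian, so the strong concavity
estimate becomes quadratic growth of the proximal objective around its minimizer. -/
theorem IsExactMinimizer.add_le (hK : P.K.Nonempty) {σ : ℝ} (hσ : 0 < σ)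
    {x : EuclideanSpace ℝ (Fin n)} {y : EuclideanSpace ℝ (Fin m)}
    (h : P.IsExactMinimizer σ x y) {s : EuclideanSpace ℝ (Fin n)} (hs : s ∈ P.feasible) :
    ⟪P.c, P.primalUpdate σ y x⟫_ℝ + 1 / (2 * σ) * ‖P.primalUpdate σ y x - x‖ ^ 2
        + 1 / (2 * σ) * ‖s - P.primalUpdate σ y x‖ ^ 2
      ≤ ⟪P.c, s⟫_ℝ + 1 / (2 * σ) * ‖s - x‖ ^ 2 := by
  have h1 := lagrangian_sub_add_le hK hσ y x hs.1
  rw [lagrangian_of_map_eq hs.2, lagrangian_of_map_eq (h.map_primalUpdate hK hσ)] at h1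
  linarith

theorem IsExactMinimizer.isProxSolution (hK : P.K.Nonempty) {σ : ℝ} (hσ : 0 < σ)
    {x : EuclideanSpace ℝ (Fin n)} {y : EuclideanSpace ℝ (Fin m)}
    (h : P.IsExactMinimizer σ x y) : P.IsProxSolution σ x (P.primalUpdate σ y x) := by
  refine ⟨h.mem_feasible hK hσ, fun s hs => ?_⟩
  have h1 := h.add_le hK hσ hs
  have h2 : 0 ≤ 1 / (2 * σ) * ‖s - P.primalUpdate σ y x‖ ^ 2 := by positivity
  simp only [Set.mem_ofPred_eq]
  linarith

theorem IsExactMinimizer.eq_of_isProxSolution (hK : P.K.Nonempty) {σ : ℝ} (hσ : 0 < σ)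
    {x s : EuclideanSpace ℝ (Fin n)} {y : EuclideanSpace ℝ (Fin m)}
    (h : P.IsExactMinimizer σ x y) (hs : P.IsProxSolution σ x s) :
    s = P.primalUpdate σ y x := by
  have h1 := h.add_le hK hσ hs.1
  have h2 := hs.2 (h.mem_feasible hK hσ)
  simp only [Set.mem_ofPred_eq] at h2
  have h3 : ‖s - P.primalUpdate σ y x‖ ^ 2 ≤ 0 := by
    by_contra hneg
    have : 0 < 1 / (2 * σ) * ‖s - P.primalUpdate σ y x‖ ^ 2 :=
      mul_pos (by positivity) (not_le.mp hneg)
    linarith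
  have h4 : ‖s - P.primalUpdate σ y x‖ = 0 := by
    have := sq_nonneg ‖s - P.primalUpdate σ y x‖
    exact pow_eq_zero_iff two_ne_zero |>.mp (le_antisymm h3 this)
  exact sub_eq_zero.mp (norm_eq_zero.mp h4)

theorem IsPrimalSolution.isProxSolution_self {x : EuclideanSpace ℝ (Fin n)}
    (h : P.IsPrimalSolution x) {σ : ℝ} (hσ : 0 < σ) : P.IsProxSolution σ x x := by
  refine ⟨h.1, fun s hs => ?_⟩
  have h1 := h.2 hs
  simp only [Set.mem_ofPred_eq] at h1 ⊢
  have h2 : 0 ≤ 1 / (2 * σ) * ‖s - x‖ ^ 2 := by positivity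
  simpa using h1.trans (le_add_of_nonneg_right h2)

/-! ### Dual optimality -/

theorem inner_sub_adj (y : EuclideanSpace ℝ (Fin m)) (d : EuclideanSpace ℝ (Fin n)) :
    ⟪P.c - P.adj y, d⟫_ℝ = ⟪P.c, d⟫_ℝ - ⟪y, P.map d⟫_ℝ := by
  rw [inner_sub_left, inner_adj]

/-- A multiplier satisfying the optimality conditions at a feasible point solves the dual. -/
theorem isDualSolution_of_forall_nonneg {x : EuclideanSpace ℝ (Fin n)} (hx : x ∈ P.feasible)
    {y : EuclideanSpace ℝ (Fin m)} (h : ∀ d ∈ P.K, 0 ≤ ⟪P.c - P.adj y, d - x⟫_ℝ) :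
    P.IsDualSolution y := by
  -- Because `A x = b`, replacing the supremum by its term at `x` gives `cᵀx` for every `z`: this is
  -- weak duality, with equality when `x` attains the supremum.
  have hval : ∀ z, -⟪x, P.adj z - P.c⟫_ℝ + ⟪P.b, z⟫_ℝ = ⟪P.c, x⟫_ℝ := by
    intro z
    rw [real_inner_comm, inner_sub_left, inner_adj, hx.2, real_inner_comm z]
    ring
  have hweak : ∀ z, P.dualObj z ≤ ((⟪P.c, x⟫_ℝ : ℝ) : EReal) := by
    intro z
    have h1 : ((⟪x, P.adj z - P.c⟫_ℝ : ℝ) : EReal) ≤ indicatorConj P.K (P.adj z - P.c) :=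
      le_iSup₂ (f := fun (s : EuclideanSpace ℝ (Fin n)) (_ : s ∈ P.K) =>
        ((⟪s, P.adj z - P.c⟫_ℝ : ℝ) : EReal)) x hx.1
    refine (add_le_add_left (EReal.neg_le_neg_iff.mpr h1) _).trans ?_
    rw [← EReal.coe_neg, ← EReal.coe_add, hval]
  have heq : P.dualObj y = ((⟪P.c, x⟫_ℝ : ℝ) : EReal) := by
    refine le_antisymm (hweak y) ?_
    have h1 : indicatorConj P.K (P.adj y - P.c) ≤ ((⟪x, P.adj y - P.c⟫_ℝ : ℝ) : EReal) := by
      refine iSup₂_le fun d hd => EReal.coe_le_coe_iff.mpr ?_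
      have h2 := h d hd
      rw [← neg_sub P.c (P.adj y), inner_neg_right, inner_neg_right, real_inner_comm,
        real_inner_comm _ x]
      rw [inner_sub_right] at h2
      linarith
    refine le_trans ?_ (add_le_add_left (EReal.neg_le_neg_iff.mpr h1) _)
    rw [← EReal.coe_neg, ← EReal.coe_add, hval]
  refine ⟨by rw [heq]; exact EReal.coe_ne_bot _, fun z _ => ?_⟩
  simp only [Set.mem_ofPred_eq]
  rw [heq]
  exact hweak z

/-- An optimal prox center is its own prox point, so in the projection inequality the center cancels
and only `-σ (c - A^* y)` remains. -/
theorem IsExactMinimizer.isDualSolution (hK : P.K.Nonempty) {σ : ℝ} (hσ : 0 < σ)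
    {x : EuclideanSpace ℝ (Fin n)} {y : EuclideanSpace ℝ (Fin m)}
    (h : P.IsExactMinimizer σ x y) (hx : P.IsPrimalSolution x) : P.IsDualSolution y := by
  have hfix := h.eq_of_isProxSolution hK hσ (hx.isProxSolution_self hσ)
  refine isDualSolution_of_forall_nonneg hx.1 fun d hd => ?_
  have h1 := (primalUpdate_spec hK σ y x).2 d hd
  rw [← hfix, show x - σ • (P.c - P.adj y) - x = -(σ • (P.c - P.adj y)) by abel, inner_neg_left,
    real_inner_smul_left] at h1
  exact nonneg_of_mul_nonneg_right (by linarith) hσ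

/-! ### Cones of feasible directions and multipliers -/

variable (P) in
/-- The directions in the kernel of `A` that respect the lower bounds in `I` and the upper
bounds in `J`. -/
def dirCone (I J : Set (Fin n)) : Set (EuclideanSpace ℝ (Fin n)) :=
  {d | P.map d = 0 ∧ (∀ i ∈ I, 0 ≤ d i) ∧ ∀ i ∈ J, d i ≤ 0}

variable (P) in
/-- The components at which the lower bound is active. -/
def activeLower (x : EuclideanSpace ℝ (Fin n)) : Set (Fin n) :=
  {i | P.l i = ((x i : ℝ) : EReal)}

variable (P) in
/-- The components at which the upper bound is active. -/
def activeUpper (x : EuclideanSpace ℝ (Fin n)) : Set (Fin n) :=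
  {i | P.u i = ((x i : ℝ) : EReal)}

theorem nonneg_sub_of_mem_activeLower {x d : EuclideanSpace ℝ (Fin n)} (hd : d ∈ P.K) {i : Fin n}
    (hi : i ∈ P.activeLower x) : 0 ≤ (d - x) i := by
  have h1 := (hd i).1
  have hi : P.l i = ((x i : ℝ) : EReal) := hi
  rw [hi, EReal.coe_le_coe_iff] at h1
  simpa using h1

theorem sub_nonpos_of_mem_activeUpper {x d : EuclideanSpace ℝ (Fin n)} (hd : d ∈ P.K) {i : Fin n}
    (hi : i ∈ P.activeUpper x) : (d - x) i ≤ 0 := by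
  have h1 := (hd i).2
  have hi : P.u i = ((x i : ℝ) : EReal) := hi
  rw [hi, EReal.coe_le_coe_iff] at h1
  simpa using h1

theorem sub_mem_dirCone {x d : EuclideanSpace ℝ (Fin n)} (hx : x ∈ P.feasible)
    (hd : d ∈ P.feasible) : d - x ∈ P.dirCone (P.activeLower x) (P.activeUpper x) :=
  ⟨by rw [map_sub, hx.2, hd.2, sub_self], fun _ hi => nonneg_sub_of_mem_activeLower hd.1 hi,
    fun _ hi => sub_nonpos_of_mem_activeUpper hd.1 hi⟩

/-- Inactive bounds are strict and survive a short step; active ones are respected by the signs of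
`d`. -/
theorem exists_pos_add_smul_mem_feasible {x d : EuclideanSpace ℝ (Fin n)} (hx : x ∈ P.feasible)
    (hd : d ∈ P.dirCone (P.activeLower x) (P.activeUpper x)) :
    ∃ t : ℝ, 0 < t ∧ x + t • d ∈ P.feasible := by
  have hev : ∀ i, ∀ᶠ t : ℝ in 𝓝[>] 0, P.l i ≤ (((x + t • d) i : ℝ) : EReal) ∧
      (((x + t • d) i : ℝ) : EReal) ≤ P.u i := by
    intro i
    have hc : Continuous fun t : ℝ => (((x + t • d) i : ℝ) : EReal) :=
      continuous_coe_real_ereal.comp (by simp only [PiLp.add_apply, PiLp.smul_apply]; fun_prop)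
    have hc0 : Tendsto (fun t : ℝ => (((x + t • d) i : ℝ) : EReal)) (𝓝[>] 0)
        (𝓝 ((x i : ℝ) : EReal)) := by
      have := (hc.tendsto 0).mono_left (nhdsWithin_le_nhds (s := Set.Ioi 0))
      simpa using this
    refine Filter.Eventually.and ?_ ?_
    · rcases (hx.1 i).1.lt_or_eq with h | h
      · exact (hc0.eventually_const_lt h).mono fun _ => le_of_lt
      · filter_upwards [self_mem_nhdsWithin] with t ht
        rw [h, EReal.coe_le_coe_iff]
        have := mul_nonneg (le_of_lt (Set.mem_Ioi.mp ht)) (hd.2.1 i h)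
        simpa using this
    · rcases (hx.1 i).2.lt_or_eq with h | h
      · exact (hc0.eventually_lt_const h).mono fun _ => le_of_lt
      · filter_upwards [self_mem_nhdsWithin] with t ht
        rw [← h, EReal.coe_le_coe_iff]
        have := mul_nonpos_of_nonneg_of_nonpos (le_of_lt (Set.mem_Ioi.mp ht)) (hd.2.2 i h.symm)
        simpa using this
  obtain ⟨t, ht, ht0⟩ := ((Filter.eventually_all.mpr hev).and self_mem_nhdsWithin).exists
  exact ⟨t, ht0, ht, by rw [map_add_smul, hd.1, hx.2, smul_zero, add_zero]⟩

/-- Makes first-order optimality depend on `x` only through its active sets, of which there are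
finitely many. -/
theorem forall_feasible_inner_nonneg_iff {x : EuclideanSpace ℝ (Fin n)} (hx : x ∈ P.feasible)
    (v : EuclideanSpace ℝ (Fin n)) :
    (∀ s ∈ P.feasible, 0 ≤ ⟪v, s - x⟫_ℝ) ↔
      ∀ d ∈ P.dirCone (P.activeLower x) (P.activeUpper x), 0 ≤ ⟪v, d⟫_ℝ := by
  refine ⟨fun h d hd => ?_, fun h s hs => h _ (sub_mem_dirCone hx hs)⟩
  obtain ⟨t, ht, hmem⟩ := exists_pos_add_smul_mem_feasible hx hd
  have h1 := h _ hmem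
  rw [add_sub_cancel_left, real_inner_smul_right] at h1
  exact nonneg_of_mul_nonneg_right h1 ht

theorem isPrimalSolution_iff {x : EuclideanSpace ℝ (Fin n)} (hx : x ∈ P.feasible) :
    P.IsPrimalSolution x ↔ ∀ s ∈ P.feasible, 0 ≤ ⟪P.c, s - x⟫_ℝ := by
  simp only [inner_sub_right, sub_nonneg]
  exact ⟨fun h => h.2, fun h => ⟨hx, h⟩⟩

/-- A primal solution of a linear program admits a Lagrange multiplier. -/
theorem IsPrimalSolution.exists_multiplier {x : EuclideanSpace ℝ (Fin n)}
    (h : P.IsPrimalSolution x) : ∃ y, ∀ d ∈ P.K, 0 ≤ ⟪P.c - P.adj y, d - x⟫_ℝ := by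
  classical
  have hc := (forall_feasible_inner_nonneg_iff h.1 P.c).mp ((isPrimalSolution_iff h.1).mp h)
  let row : Fin m → EuclideanSpace ℝ (Fin n) →ₗ[ℝ] ℝ := fun j =>
    (EuclideanSpace.proj j : EuclideanSpace ℝ (Fin m) →L[ℝ] ℝ).toLinearMap ∘ₗ
      Matrix.toEuclideanLin P.A
  let coord : Fin n → EuclideanSpace ℝ (Fin n) →ₗ[ℝ] ℝ := fun i =>
    (EuclideanSpace.proj i : EuclideanSpace ℝ (Fin n) →L[ℝ] ℝ).toLinearMap
  -- The equation `A d = 0` enters as two opposite inequalities; an inactive bound gets the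
  -- functional `0`, which imposes nothing.
  let f : (Fin m ⊕ Fin m) ⊕ (Fin n ⊕ Fin n) → EuclideanSpace ℝ (Fin n) →ₗ[ℝ] ℝ :=
    Sum.elim (Sum.elim row fun j => -row j)
      (Sum.elim (fun i => if i ∈ P.activeLower x then coord i else 0)
        fun i => if i ∈ P.activeUpper x then -coord i else 0)
  obtain ⟨w, hw, hsum⟩ := exists_nonneg_sum_smul_eq_of_forall_nonneg Finset.univ f
    (innerSL ℝ P.c).toLinearMap (by
      intro d hd
      refine hc d ⟨?_, fun i hi => ?_, fun i hi => ?_⟩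
      · ext j
        have h1 : 0 ≤ P.map d j := hd (.inl (.inl j)) (Finset.mem_univ _)
        have h2 : 0 ≤ -P.map d j := hd (.inl (.inr j)) (Finset.mem_univ _)
        simp only [PiLp.zero_apply]
        linarith
      · have h1 := hd (.inr (.inl i)) (Finset.mem_univ _)
        simpa [f, hi, coord] using h1
      · have h1 := hd (.inr (.inr i)) (Finset.mem_univ _)
        simpa [f, hi, coord] using h1)
  -- The multiplier is the difference of the weights of the two opposite row inequalities; what is
  -- left are bound terms, nonnegative on all of `K`.
  refine ⟨WithLp.toLp 2 fun j => w (.inl (.inl j)) - w (.inl (.inr j)), fun d hd => ?_⟩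
  have h1 : ⟪P.c, d - x⟫_ℝ = _ := hsum (d - x)
  rw [Fintype.sum_sum_type, Fintype.sum_sum_type, Fintype.sum_sum_type] at h1
  have h2 : ⟪(WithLp.toLp 2 fun j => w (.inl (.inl j)) - w (.inl (.inr j)) :
      EuclideanSpace ℝ (Fin m)), P.map (d - x)⟫_ℝ
      = ∑ j, w (.inl (.inl j)) * f (.inl (.inl j)) (d - x)
        + ∑ j, w (.inl (.inr j)) * f (.inl (.inr j)) (d - x) := by
    rw [← Finset.sum_add_distrib, PiLp.inner_apply]
    refine Finset.sum_congr rfl fun j _ => ?_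
    have h3 : f (.inl (.inl j)) (d - x) = P.map (d - x) j := rfl
    have h4 : f (.inl (.inr j)) (d - x) = -P.map (d - x) j := rfl
    rw [h3, h4]
    simp only [RCLike.inner_apply, conj_trivial]
    ring
  have h5 : ∀ i, 0 ≤ w (.inr i) * f (.inr i) (d - x) := by
    refine fun i => mul_nonneg (hw _) ?_
    rcases i with i | i
    · by_cases hi : i ∈ P.activeLower x
      · have := nonneg_sub_of_mem_activeLower hd hi
        simpa [f, hi, coord] using this
      · simp [f, hi]
    · by_cases hi : i ∈ P.activeUpper x
      · have := sub_nonpos_of_mem_activeUpper hd hi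
        simpa [f, hi, coord] using this
      · simp [f, hi]
  have h6 := Finset.sum_nonneg fun i (_ : i ∈ Finset.univ) => h5 (.inl i)
  have h7 := Finset.sum_nonneg fun i (_ : i ∈ Finset.univ) => h5 (.inr i)
  rw [inner_sub_adj, h1, h2]
  linarith

variable (P) in
/-- A point that minimizes a slightly perturbed cost over the feasible set solves the linear
program: there are finitely many cones of feasible directions. -/
theorem exists_pos_isPrimalSolution_of_perturbation :
    ∃ r : ℝ, 0 < r ∧ ∀ e : EuclideanSpace ℝ (Fin n), ‖e‖ < r → ∀ p ∈ P.feasible,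
      (∀ s ∈ P.feasible, 0 ≤ ⟪P.c + e, s - p⟫_ℝ) → P.IsPrimalSolution p := by
  -- For each pair of active sets, either `c` is already nonnegative on the cone, or a direction
  -- violating this still does so for all nearby costs.
  have hev : ∀ IJ : Set (Fin n) × Set (Fin n), ∀ᶠ e in 𝓝 (0 : EuclideanSpace ℝ (Fin n)),
      (∀ d ∈ P.dirCone IJ.1 IJ.2, 0 ≤ ⟪P.c + e, d⟫_ℝ) →
        ∀ d ∈ P.dirCone IJ.1 IJ.2, 0 ≤ ⟪P.c, d⟫_ℝ := by
    rintro ⟨I, J⟩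
    by_cases h : ∀ d ∈ P.dirCone I J, 0 ≤ ⟪P.c, d⟫_ℝ
    · exact Eventually.of_forall fun _ _ => h
    · push Not at h
      obtain ⟨d, hd, hneg⟩ := h
      have hcont : Continuous fun e => ⟪P.c + e, d⟫_ℝ := by fun_prop
      have : ∀ᶠ e in 𝓝 (0 : EuclideanSpace ℝ (Fin n)), ⟪P.c + e, d⟫_ℝ < 0 :=
        hcont.tendsto 0 |>.eventually_lt_const (by simpa using hneg)
      exact this.mono fun e he h' => absurd (h' d hd) (not_le.mpr he)
  obtain ⟨r, hr, hball⟩ := Metric.eventually_nhds_iff.mp (Filter.eventually_all.mpr hev)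
  refine ⟨r, hr, fun e he p hp hpe => ?_⟩
  rw [isPrimalSolution_iff hp, forall_feasible_inner_nonneg_iff hp]
  rw [forall_feasible_inner_nonneg_iff hp] at hpe
  exact hball (by simpa using he) (_, _) hpe

/-! ### The penalty threshold -/

/-- The projection inequality divided by `-σ`; the term in `A^* y` vanishes because `A (s - p) = 0`.
-/
theorem IsExactMinimizer.inner_nonneg (hK : P.K.Nonempty) {σ : ℝ} (hσ : 0 < σ)
    {x : EuclideanSpace ℝ (Fin n)} {y : EuclideanSpace ℝ (Fin m)}
    (h : P.IsExactMinimizer σ x y) {s : EuclideanSpace ℝ (Fin n)} (hs : s ∈ P.feasible) :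
    0 ≤ ⟪P.c + (1 / σ) • (P.primalUpdate σ y x - x), s - P.primalUpdate σ y x⟫_ℝ := by
  have h1 := (primalUpdate_spec hK σ y x).2 s hs.1
  have h2 := h.map_primalUpdate hK hσ
  set p := P.primalUpdate σ y x
  have h3 := P.inner_sub_adj y (s - p)
  rw [map_sub, hs.2, h2, sub_self, inner_zero_right, sub_zero] at h3
  rw [show x - σ • (P.c - P.adj y) - p = -(σ • ((P.c - P.adj y) + (1 / σ) • (p - x))) by
    rw [smul_add, smul_smul, mul_one_div_cancel hσ.ne']; module, inner_neg_left,
    real_inner_smul_left, inner_add_left, h3, ← inner_add_left] at h1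
  exact nonneg_of_mul_nonneg_right (by linarith) hσ

/-- Testing with `s = z` and using `cᵀz ≤ cᵀp` leaves `⟪p - x, z - p⟫ ≥ 0`. -/
theorem IsExactMinimizer.norm_sub_le (hK : P.K.Nonempty) {σ : ℝ} (hσ : 0 < σ)
    {x z : EuclideanSpace ℝ (Fin n)} {y : EuclideanSpace ℝ (Fin m)}
    (h : P.IsExactMinimizer σ x y) (hz : P.IsPrimalSolution z) :
    ‖P.primalUpdate σ y x - x‖ ≤ ‖x - z‖ := by
  have h1 := h.inner_nonneg hK hσ hz.1
  have h2 : ⟪P.c, z - P.primalUpdate σ y x⟫_ℝ ≤ 0 := by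
    rw [inner_sub_right, sub_nonpos]
    exact hz.2 (h.mem_feasible hK hσ)
  set p := P.primalUpdate σ y x
  rw [inner_add_left, real_inner_smul_left] at h1
  have h3 : 0 ≤ ⟪p - x, z - p⟫_ℝ :=
    nonneg_of_mul_nonneg_right (by linarith : 0 ≤ 1 / σ * ⟪p - x, z - p⟫_ℝ) (by positivity)
  rw [show z - p = -(x - z) - (p - x) by abel, inner_sub_right, inner_neg_right,
    real_inner_self_eq_norm_sq] at h3
  have h4 := (abs_le.mp (abs_real_inner_le_norm (p - x) (x - z))).1
  have h5 : ‖p - x‖ * ‖p - x‖ ≤ ‖p - x‖ * ‖x - z‖ := by nlinarith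
  by_cases h0 : ‖p - x‖ = 0
  · rw [h0]; exact norm_nonneg _
  · exact le_of_mul_le_mul_left h5 (lt_of_le_of_ne (norm_nonneg _) (Ne.symm h0))

/-- From bounded prox centers, a large penalty reaches a primal solution in one exact step. -/
theorem exists_threshold_isPrimalSolution {z : EuclideanSpace ℝ (Fin n)}
    (hz : P.IsPrimalSolution z) (R : ℝ) :
    ∃ σ₀ : ℝ, 0 < σ₀ ∧ ∀ σ, σ₀ ≤ σ → ∀ (x : EuclideanSpace ℝ (Fin n)), ‖x - z‖ ≤ R →
      ∀ y, P.IsExactMinimizer σ x y → P.IsPrimalSolution (P.primalUpdate σ y x) := by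
  have hK : P.K.Nonempty := ⟨z, hz.1.1⟩
  obtain ⟨r, hr, hpert⟩ := P.exists_pos_isPrimalSolution_of_perturbation
  -- Chosen so that `‖p - x‖ / σ ≤ R / σ < r`; `|R| + 1` secures positivity and the strict
  -- inequality.
  refine ⟨(|R| + 1) / r, by positivity, fun σ hσ x hx y hy => ?_⟩
  have hpos : 0 < σ := lt_of_lt_of_le (by positivity) hσ
  refine hpert ((1 / σ) • (P.primalUpdate σ y x - x)) ?_ _ (hy.mem_feasible hK hpos)
    fun s hs => hy.inner_nonneg hK hpos hs
  have h1 := hy.norm_sub_le hK hpos hz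
  rw [norm_smul, Real.norm_of_nonneg (by positivity), one_div, inv_mul_lt_iff₀ hpos]
  rw [div_le_iff₀ hr] at hσ
  have := le_abs_self R
  linarith

/-! ### Fejér monotonicity and boundedness of the iterates -/

/-- One inexact step is Fejér monotone with respect to saddle points up to the error. -/
theorem inexact_step_le {σ τ ε : ℝ} (hσ : 0 < σ) (hτ : 0 < τ) (hε : 0 ≤ ε)
    {x z : EuclideanSpace ℝ (Fin n)} {y₀ y w : EuclideanSpace ℝ (Fin m)} (hz : z ∈ P.feasible)
    (hw : ∀ d ∈ P.K, 0 ≤ ⟪P.c - P.adj w, d - z⟫_ℝ)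
    (hgrad : ‖gradient (P.innerObj σ τ x y₀) y‖ ≤ min (Real.sqrt τ) 1 / σ * ε) :
    Real.sqrt (‖P.primalUpdate σ y x - z‖ ^ 2 + τ * ‖y - w‖ ^ 2)
      ≤ Real.sqrt (‖x - z‖ ^ 2 + τ * ‖y₀ - w‖ ^ 2) + ε := by
  have hK : P.K.Nonempty := ⟨z, hz.1⟩
  rw [(hasGradientAt_innerObj hK hσ τ x y₀ y).gradient] at hgrad
  obtain ⟨hp, hvi⟩ := primalUpdate_spec hK σ y x
  have h1 := hvi z hz.1
  set p := P.primalUpdate σ y x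
  set g := P.map p - P.b + (τ / σ) • (y - y₀) with hg
  have h2 := hw p hp
  have h3 : ⟪x - p, z - p⟫_ℝ ≤ σ * ⟪P.c - P.adj y, z - p⟫_ℝ := by
    rw [show x - σ • (P.c - P.adj y) - p = (x - p) - σ • (P.c - P.adj y) by abel, inner_sub_left,
      real_inner_smul_left] at h1
    linarith
  -- Adding the optimality condition of `w` at `p` eliminates `c`.
  have h4 : ⟪P.c - P.adj y, z - p⟫_ℝ ≤ ⟪y - w, P.map p - P.b⟫_ℝ := by
    rw [inner_sub_adj, map_sub, hz.2, inner_sub_right, inner_sub_right] at h2 ⊢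
    rw [inner_sub_left, inner_sub_right, inner_sub_right]
    linarith
  have h5 : σ * ⟪y - w, P.map p - P.b⟫_ℝ = σ * ⟪y - w, g⟫_ℝ - τ * ⟪y - w, y - y₀⟫_ℝ := by
    rw [hg, inner_add_right _ (P.map p - P.b), real_inner_smul_right]
    field_simp
    ring
  -- The factor `1 / σ` in the stopping rule absorbs `σ`, and `√τ` turns `‖y - w‖` into a quantity
  -- bounded by the new distance `D'`.
  have h6 : σ * ⟪y - w, g⟫_ℝ ≤ ε * (Real.sqrt τ * ‖y - w‖) := by
    have h7 := real_inner_le_norm (y - w) g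
    have h8 : σ * ‖g‖ ≤ Real.sqrt τ * ε := by
      have : σ * ‖g‖ ≤ σ * (min (Real.sqrt τ) 1 / σ * ε) := mul_le_mul_of_nonneg_left hgrad hσ.le
      rw [← mul_assoc, mul_div_cancel₀ _ hσ.ne'] at this
      exact this.trans (mul_le_mul_of_nonneg_right (min_le_left _ _) hε)
    have h9 := mul_le_mul_of_nonneg_left h7 hσ.le
    have h10 := mul_le_mul_of_nonneg_left h8 (norm_nonneg (y - w))
    linarith
  have h11 : ⟪x - p, z - p⟫_ℝ = ‖p - z‖ ^ 2 - ⟪x - z, p - z⟫_ℝ := by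
    rw [← real_inner_self_eq_norm_sq, ← inner_sub_left, show z - p = -(p - z) by abel,
      inner_neg_right, ← inner_neg_left]
    congr 1; abel
  have h12 : ⟪y - w, y - y₀⟫_ℝ = ‖y - w‖ ^ 2 - ⟪y₀ - w, y - w⟫_ℝ := by
    rw [real_inner_comm _ (y₀ - w), ← real_inner_self_eq_norm_sq, ← inner_sub_right]
    congr 1; abel
  have h13 := real_inner_le_norm (x - z) (p - z)
  have h14 := real_inner_le_norm (y₀ - w) (y - w)
  set t := Real.sqrt τ
  have ht : 0 ≤ t := Real.sqrt_nonneg _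
  have htt : τ = t ^ 2 := (Real.sq_sqrt hτ.le).symm
  set D' := Real.sqrt (‖p - z‖ ^ 2 + τ * ‖y - w‖ ^ 2)
  set D := Real.sqrt (‖x - z‖ ^ 2 + τ * ‖y₀ - w‖ ^ 2)
  have hD' : D' ^ 2 = ‖p - z‖ ^ 2 + τ * ‖y - w‖ ^ 2 := Real.sq_sqrt (by positivity)
  have hD : D ^ 2 = ‖x - z‖ ^ 2 + τ * ‖y₀ - w‖ ^ 2 := Real.sq_sqrt (by positivity)
  have hD'0 : 0 ≤ D' := Real.sqrt_nonneg _
  have hD0 : 0 ≤ D := Real.sqrt_nonneg _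
  -- Cauchy–Schwarz for the product norm weighted by `τ`; with it all terms combine to `D'² ≤ (D +
  -- ε) D'`.
  have hcs : ‖x - z‖ * ‖p - z‖ + τ * (‖y₀ - w‖ * ‖y - w‖) ≤ D * D' := by
    refine abs_le_of_sq_le_sq' ?_ (by positivity) |>.2
    rw [mul_pow, hD, hD', htt]
    nlinarith [sq_nonneg (‖x - z‖ * (t * ‖y - w‖) - ‖p - z‖ * (t * ‖y₀ - w‖))]
  have hle : t * ‖y - w‖ ≤ D' := by
    refine abs_le_of_sq_le_sq' ?_ hD'0 |>.2
    rw [hD', htt, mul_pow]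
    nlinarith [sq_nonneg ‖p - z‖]
  have h15 := mul_le_mul_of_nonneg_left h14 hτ.le
  have h16 := mul_le_mul_of_nonneg_left hle hε
  have h17 := mul_le_mul_of_nonneg_left h4 hσ.le
  have hmain : D' * D' ≤ (D + ε) * D' := by nlinarith
  by_cases h0 : D' = 0
  · rw [h0]; positivity
  · exact le_of_mul_le_mul_right hmain (lt_of_le_of_ne hD'0 (Ne.symm h0))

theorem IsSnipalSequence.exists_bound {σ τ ε : ℕ → ℝ} {y : ℕ → EuclideanSpace ℝ (Fin m)}
    {x : ℕ → EuclideanSpace ℝ (Fin n)} (h : P.IsSnipalSequence σ τ ε y x)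
    (hτ : ∀ k, 0 < τ k) (hanti : Antitone τ) {z : EuclideanSpace ℝ (Fin n)}
    (hz : P.IsPrimalSolution z) : ∃ R : ℝ, ∀ k, ‖x k - z‖ ≤ R := by
  obtain ⟨w, hw⟩ := hz.exists_multiplier
  set D : ℕ → ℝ := fun k => Real.sqrt (‖x k - z‖ ^ 2 + τ k * ‖y k - w‖ ^ 2) with hD
  have hstep : ∀ k, D (k + 1) ≤ D k + ε k := by
    intro k
    have h1 := inexact_step_le (h.sigma_pos k) (hτ k) (h.eps_nonneg k) hz.1 hw (h.stopping k)
    rw [← h.update k] at h1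
    -- The metric changes with `k`; as `τ` is nonincreasing, passing to the weight `τ (k + 1)` only
    -- shrinks the distance.
    refine le_trans (Real.sqrt_le_sqrt ?_) h1
    have := mul_le_mul_of_nonneg_right (hanti k.le_succ) (sq_nonneg ‖y (k + 1) - w‖)
    simpa using this
  have hsum : ∀ k, D k ≤ D 0 + ∑ i ∈ Finset.range k, ε i := by
    intro k
    induction k with
    | zero => simp
    | succ k ih =>
      rw [Finset.sum_range_succ]
      linarith [hstep k]
  refine ⟨D 0 + ∑' i, ε i, fun k => ?_⟩
  have h1 : ‖x k - z‖ ≤ D k := by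
    refine Real.le_sqrt_of_sq_le (le_add_of_nonneg_right ?_)
    exact mul_nonneg (hτ k).le (sq_nonneg _)
  have h2 := h.eps_summable.sum_le_tsum (Finset.range k) fun i _ => h.eps_nonneg i
  linarith [hsum k]

end LPData

end Snipal

theorem mainTheorem5 {m n : ℕ} (P : Snipal.LPData m n) (hP : P.SolvableFullRank)
    (σ τ ε : ℕ → ℝ) (hτ : Snipal.DecreasesToPos τ)
    (y : ℕ → EuclideanSpace ℝ (Fin m)) (x : ℕ → EuclideanSpace ℝ (Fin n))
    (hseq : P.IsSnipalSequence σ τ ε y x) :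
    -- (a)
    (∀ (k : ℕ) (ybar : EuclideanSpace ℝ (Fin m)), P.IsExactMinimizer (σ k) (x k) ybar →
      P.IsProxSolution (σ k) (x k) (P.primalUpdate (σ k) ybar (x k)) ∧
      ∀ x' : EuclideanSpace ℝ (Fin n), P.IsProxSolution (σ k) (x k) x' →
        x' = P.primalUpdate (σ k) ybar (x k)) ∧
    -- (b), for every penalty value `s` above the threshold, in particular for `s = σ k`
    (∃ σbar : ℝ, 0 < σbar ∧
      ∀ (k : ℕ) (s : ℝ), σbar ≤ s →
        ∀ ybar : EuclideanSpace ℝ (Fin m), P.IsExactMinimizer s (x k) ybar →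
          P.IsPrimalSolution (P.primalUpdate s ybar (x k))) ∧
    -- (c)
    (∀ (k : ℕ) (ybar : EuclideanSpace ℝ (Fin m)), P.IsExactMinimizer (σ k) (x k) ybar →
      P.IsPrimalSolution (x k) → P.IsDualSolution ybar) := by
  obtain ⟨⟨z, hz⟩, -, -⟩ := hP
  have hK : P.K.Nonempty := ⟨z, hz.1.1⟩
  refine ⟨fun k ybar h => ⟨h.isProxSolution hK (hseq.sigma_pos k), fun x' hx' =>
    h.eq_of_isProxSolution hK (hseq.sigma_pos k) hx'⟩, ?_, fun k ybar h hx =>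
    h.isDualSolution hK (hseq.sigma_pos k) hx⟩
  obtain ⟨R, hR⟩ := hseq.exists_bound hτ.1 hτ.2.1 hz
  obtain ⟨σ₀, hσ₀, hmain⟩ := Snipal.LPData.exists_threshold_isPrimalSolution hz R
  exact ⟨σ₀, hσ₀, fun k s hs ybar h => hmain s hs (x k) (hR k) ybar h⟩
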